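/- Let $X$ be a finite simple graph with adjacency matrix $A$, and let $U(t)=e^{itA}$ for real $t\ge 0$. We say that $X$ admits perfect state transfer at time $\tau$ if there are distinct vertices $u,v$ of $X$ and some $\gamma\in\mathbb{C}$ with $U(\tau)e_u=\gamma e_v$, where $e_w$ denotes the characteristic vector of the vertex $w$. A $2$-fold cover of $K_n$ is a graph $X$ whose vertex set is partitioned into $n$ independent sets (cells) of size $2$ such that the edges between any two different cells form a perfect matching. A graph is distance-regular if it is connected and there are numbers $b_i,c_i$ ($i\ge 0$) such that, for any vertices $u,v$ at distance $i$, exactly $c_i$ neighbours of $v$ are at distance $i-1$ from $u$ and exactly $b_i$ neighbours of $v$ are at distance $i+1$ from $u$. Theorem. Let $X$ be a distance-regular $2$-fold cover of $K_n$, let $c$ be the number of common neighbours of any two vertices of $X$ at distance $2$, and put $\delta=n-2c-2$. (a) If $\delta=-2$, then $X$ admits perfect state transfer at time $\pi/\sqrt{n}$. (b) If $\delta=2$, then $X$ admits perfect state transfer (at some time) if and only if $8$ divides $n$; and if $8$ divides $n$, then $X$ admits perfect state transfer at time $\pi/2$. -/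

import Mathlib

namespace QuantumWalk

/-- A graph is distance-regular if it is connected and there are numbers `b i`, `c i` such that for
any vertices `u`, `v` at distance `i`, exactly `c i` neighbours of `v` are at distance `i - 1` from
`u` and exactly `b i` neighbours of `v` are at distance `i + 1` from `u`. (For `i = 0` no vertex
is at distance `i - 1`.) -/
def IsDistanceRegular {V : Type*} (X : SimpleGraph V) : Prop :=
  X.Connected ∧ ∃ b c : ℕ → ℕ, ∀ (i : ℕ) (u v : V), X.dist u v = i →
    {w : V | X.Adj v w ∧ X.dist u w + 1 = i}.ncard = c i ∧
    {w : V | X.Adj v w ∧ X.dist u w = i + 1}.ncard = b i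

/-- The cell of a partition (given as an equivalence relation) that a point of the quotient
stands for. -/
def cell {V : Type*} (P : Setoid V) (C : Quotient P) : Set V :=
  {v : V | Quotient.mk P v = C}

/-- No edge of `X` joins `S` and `T`. -/
def NoEdgesBetween {V : Type*} (X : SimpleGraph V) (S T : Set V) : Prop :=
  ∀ u ∈ S, ∀ v ∈ T, ¬ X.Adj u v

/-- The edges of `X` that join the (disjoint) sets `S` and `T` form a perfect matching between `S`
and `T`. -/
def PerfectMatchingBetween {V : Type*} (X : SimpleGraph V) (S T : Set V) : Prop :=
  (∀ u ∈ S, ∃! v, v ∈ T ∧ X.Adj u v) ∧ (∀ v ∈ T, ∃! u, u ∈ S ∧ X.Adj u v)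

/-- Every cell of `P` is an independent set of `X`, and between any two different cells there are
either no edges or a perfect matching. -/
def IsCoveringPartition {V : Type*} (X : SimpleGraph V) (P : Setoid V) : Prop :=
  (∀ C : Quotient P, X.IsIndepSet (cell P C)) ∧
  ∀ C D : Quotient P, C ≠ D →
    NoEdgesBetween X (cell P C) (cell P D) ∨ PerfectMatchingBetween X (cell P C) (cell P D)

/-- The quotient graph `X / P`: its vertices are the cells of `P`, two different cells being
adjacent if and only if there is a perfect matching between them. -/
def quotientGraph {V : Type*} (X : SimpleGraph V) (P : Setoid V) : SimpleGraph (Quotient P) where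
  Adj C D := C ≠ D ∧ PerfectMatchingBetween X (cell P C) (cell P D)
  symm := by
    constructor
    rintro C D ⟨hne, h1, h2⟩
    refine ⟨hne.symm, ?_, ?_⟩
    · simpa only [X.adj_comm] using h2
    · simpa only [X.adj_comm] using h1
  loopless := ⟨fun _ h => h.1 rfl⟩

/-- `X` is an `r`-fold covering of `Y`: the vertices of `X` have a covering partition with all cells
of size `r`, whose quotient graph is isomorphic to `Y`. -/
def IsFoldCovering {V W : Type*} (r : ℕ) (X : SimpleGraph V) (Y : SimpleGraph W) : Prop :=
  ∃ P : Setoid V, IsCoveringPartition X P ∧ Nonempty (quotientGraph X P ≃g Y) ∧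
    ∀ C : Quotient P, (cell P C).ncard = r

/-- The parameter `δ = n - r c - 2` of an `r`-fold covering of the complete graph on `n` vertices in
which any two vertices at distance two have `c` common neighbours. -/
def coverDelta (n r c : ℕ) : ℤ := (n : ℤ) - (r : ℤ) * (c : ℤ) - 2

variable {V : Type*} [Fintype V] [DecidableEq V]

/-- The transition matrix `U(t) = exp(i t A)` of the continuous-time quantum walk on `X`, where `A`
is the adjacency matrix of `X`. -/
noncomputable def transitionMatrix (X : SimpleGraph V) [DecidableRel X.Adj] (t : ℝ) :
    Matrix V V ℂ :=
  NormedSpace.exp ((Complex.I * (t : ℂ)) • X.adjMatrix ℂ)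

/-- Perfect state transfer at time `τ` from `u` to `v`: the vertices are distinct and
`U(τ) e_u = γ e_v` for some complex number `γ`. -/
def PerfectStateTransfer (X : SimpleGraph V) [DecidableRel X.Adj] (u v : V) (τ : ℝ) : Prop :=
  u ≠ v ∧ ∃ γ : ℂ,
    (transitionMatrix X τ).mulVec (Pi.single u (1 : ℂ)) = γ • (Pi.single v (1 : ℂ) : V → ℂ)

/-- `X` admits perfect state transfer at time `τ`. -/
def AdmitsPSTAt (X : SimpleGraph V) [DecidableRel X.Adj] (τ : ℝ) : Prop :=
  ∃ u v : V, PerfectStateTransfer X u v τ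

/-- `X` admits perfect state transfer (at some time). -/
def AdmitsPST (X : SimpleGraph V) [DecidableRel X.Adj] : Prop :=
  ∃ τ : ℝ, 0 ≤ τ ∧ AdmitsPSTAt X τ

end QuantumWalk

namespace QuantumWalk

open SimpleGraph

/-! Let P be the permutation matrix of the fibre swap and J the all-ones matrix. The covering gives
A(1 + P) = J - (1 + P), so A has eigenvalues n - 1 and -1 on functions constant on cells.
Distance-regularity gives A²(1 - P) = (n - 1)(1 - P) + δA(1 - P)
(`adjMatrix_sq_mul_one_sub_swapMatrix`), so for δ = 2ε = ±2 the other eigenvalues are ε ± √n. The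
trace of a spectral projection is an integer and n is even, hence √n = 2r
(`exists_sqrt_eq_two_mul`).

Expanding U(t) in the four projections shows that U(t) = e^{-it}P once e^{it(n-1)} = e^{-it} =
-e^{it(ε±√n)}; for n > 2 transfer in turn forces the phase conditions on ε ± √n
(`exp_eq_of_admitsPSTAt`). What remains is arithmetic with n = 4r²; for δ = 2 it comes down to r
being even. -/

/-! ### Combinatorics of the fibre swap -/

/-- `σ` exchanges the two vertices of each cell of a two-fold cover `X` of a complete graph. -/
structure IsFibreSwap {V : Type*} (X : SimpleGraph V) (σ : V → V) : Prop where
  ne : ∀ v, σ v ≠ v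
  invol : ∀ v, σ (σ v) = v
  not_adj : ∀ v, ¬ X.Adj v (σ v)
  adj_iff : ∀ u v, v ≠ u → v ≠ σ u → (X.Adj u v ↔ ¬ X.Adj u (σ v))

theorem IsFoldCovering.exists_isFibreSwap {V : Type*} [Fintype V] {X : SimpleGraph V} {n : ℕ}
    (h : IsFoldCovering 2 X (⊤ : SimpleGraph (Fin n))) :
    (∃ σ : V → V, IsFibreSwap X σ) ∧ Fintype.card V = 2 * n := by
  classical
  obtain ⟨P, ⟨hind, -⟩, ⟨e⟩, hcard⟩ := h
  have key : ∀ v : V, ∃ w, w ≠ v ∧ ∀ x, Quotient.mk P x = Quotient.mk P v ↔ x = v ∨ x = w := by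
    intro v
    obtain ⟨a, b, hab, hC⟩ := Set.ncard_eq_two.1 (hcard (Quotient.mk P v))
    have hx : ∀ x, Quotient.mk P x = Quotient.mk P v ↔ x = a ∨ x = b := by
      intro x
      have := Set.ext_iff.1 hC x
      simpa [cell] using this
    rcases (hx v).1 rfl with rfl | rfl
    · exact ⟨b, hab.symm, hx⟩
    · exact ⟨a, hab, fun x => (hx x).trans or_comm⟩
  choose σ hσne hσ using key
  have hq : ∀ v, Quotient.mk P (σ v) = Quotient.mk P v := fun v => (hσ v _).2 (Or.inr rfl)
  have hinv : ∀ v, σ (σ v) = v := by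
    intro v
    rcases (hσ v (σ (σ v))).1 ((hq _).trans (hq v)) with h | h
    · exact h
    · exact absurd h (hσne _)
  refine ⟨⟨σ, hσne, hinv, ?_, ?_⟩, ?_⟩
  · intro v
    exact hind (Quotient.mk P v) (show _ = _ from rfl) (show _ = _ from hq v) (hσne v).symm
  · intro u v h1 h2
    have hne : Quotient.mk P u ≠ Quotient.mk P v := by
      intro h
      rcases (hσ u v).1 h.symm with h | h
      · exact h1 h
      · exact h2 h
    have hadj : (quotientGraph X P).Adj (Quotient.mk P u) (Quotient.mk P v) :=
      e.map_adj_iff.1 (by simpa using hne)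
    obtain ⟨w, ⟨hw, huw⟩, huniq⟩ := hadj.2.1 u rfl
    constructor
    · intro h h'
      have e1 := huniq v ⟨rfl, h⟩
      have e2 := huniq (σ v) ⟨hq v, h'⟩
      exact hσne v (e2.trans e1.symm)
    · intro h
      rcases (hσ v w).1 hw with rfl | rfl
      · exact huw
      · exact absurd huw h
  · have : Fintype (Quotient P) := Fintype.ofEquiv _ e.toEquiv.symm
    have h1 := Finset.card_eq_sum_card_fiberwise (f := fun v : V => Quotient.mk P v)
      (s := Finset.univ) (t := Finset.univ) (by intro x _; simp)
    have h2 : Fintype.card (Quotient P) = n := by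
      rw [Fintype.card_congr e.toEquiv, Fintype.card_fin]
    rw [← Finset.card_univ, h1, ← h2, mul_comm, ← smul_eq_mul, ← Finset.card_univ]
    apply Finset.sum_eq_card_nsmul
    intro C _
    rw [← hcard C, ← Set.ncard_coe_finset]
    congr 1
    ext x
    simp [cell]

theorem dist_eq_two_iff {V : Type*} {X : SimpleGraph V} (hX : X.Connected) {u v : V} :
    X.dist u v = 2 ↔ u ≠ v ∧ ¬ X.Adj u v ∧ ∃ w, X.Adj u w ∧ X.Adj w v := by
  have h : X.dist u v = 2 ↔ X.edist u v = 2 := by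
    rw [← (hX u v).coe_dist_eq_edist]
    norm_cast
  rw [h, edist_eq_two_iff]
  simp only [Set.Nonempty, mem_commonNeighbors, X.adj_comm v]

/-- A connected graph without vertices at distance two is complete. -/
theorem exists_dist_eq_two {V : Type*} {X : SimpleGraph V} (hX : X.Connected) {u v : V}
    (huv : u ≠ v) (h : ¬ X.Adj u v) : ∃ a b, X.dist a b = 2 := by
  by_contra! hno
  have key : ∀ {a b : V}, X.Walk a b → a = b ∨ X.Adj a b := by
    intro a b p
    induction p with
    | nil => exact Or.inl rfl
    | @cons x y z hxy _ ih =>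
      rcases ih with rfl | hyz
      · exact Or.inr hxy
      · by_contra! hc
        exact hno x z ((dist_eq_two_iff hX).2 ⟨hc.1, hc.2, y, hxy, hyz⟩)
  obtain ⟨p⟩ := hX u v
  exact (key p).elim huv h

namespace IsFibreSwap

variable {V : Type*} {X : SimpleGraph V} {σ : V → V}

theorem adj_swap (h : IsFibreSwap X σ) {u v : V} : X.Adj (σ u) (σ v) ↔ X.Adj u v := by
  have inj : Function.Involutive σ := h.invol
  by_cases h1 : v = u
  · subst h1; simp
  by_cases h2 : v = σ u
  · subst h2
    rw [h.invol, X.adj_comm]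
  have h3 : σ v ≠ u := fun hh => h2 (by rw [← hh, h.invol])
  rw [h.adj_iff u v h1 h2, X.adj_comm u, h.adj_iff (σ v) u h3.symm (by rwa [h.invol, ne_comm]),
    not_not, X.adj_comm]

/-- In a distance-regular two-fold cover of a complete graph, nonadjacent vertices of different
cells are at distance two. -/
theorem dist_eq_two [Fintype V] (h : IsFibreSwap X σ) (hX : IsDistanceRegular X) {u v : V}
    (h1 : v ≠ u) (h2 : v ≠ σ u) (h3 : ¬ X.Adj u v) : X.dist u v = 2 := by
  obtain ⟨hconn, b, c, hbc⟩ := hX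
  obtain ⟨x, y, hxy⟩ := exists_dist_eq_two hconn (h.ne u).symm (h.not_adj u)
  obtain ⟨-, -, w, hxw, hwy⟩ := (dist_eq_two_iff hconn).1 hxy
  have hb : b 1 ≠ 0 := by
    rw [← (hbc 1 x w (dist_eq_one_iff_adj.2 hxw)).2]
    exact Set.ncard_ne_zero_of_mem (a := y) ⟨hwy, hxy⟩
  have huv : X.Adj u (σ v) := by
    by_contra hn
    exact h3 ((h.adj_iff u v h1 h2).2 hn)
  rw [← (hbc 1 u (σ v) (dist_eq_one_iff_adj.2 huv)).2] at hb
  obtain ⟨z, hz, hdz⟩ := Set.nonempty_of_ncard_ne_zero hb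
  obtain ⟨hz1, hz2, -⟩ := (dist_eq_two_iff hconn).1 hdz
  refine (dist_eq_two_iff hconn).2 ⟨h1.symm, h3, σ z, ?_, ?_⟩
  · by_contra hn
    refine hz2 ((h.adj_iff u z hz1.symm ?_).2 hn)
    rintro rfl
    exact h3 (h.adj_swap.1 hz.symm)
  · rw [← h.adj_swap, h.invol]
    exact hz.symm

end IsFibreSwap

/-! ### Exponentials on eigenvectors and traces of idempotents -/

theorem exp_mul_of_mul_eq_smul {V : Type*} [Fintype V] [DecidableEq V] {M E : Matrix V V ℂ}
    {z : ℂ} (h : M * E = z • E) : NormedSpace.exp M * E = Complex.exp z • E := by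
  -- A norm is needed only for convergence of the series; the exponential itself depends only on the
  -- topology.
  let _ : NormedRing (Matrix V V ℂ) := Matrix.linftyOpNormedRing
  let _ : NormedAlgebra ℂ (Matrix V V ℂ) := Matrix.linftyOpNormedAlgebra
  have hpow : ∀ k : ℕ, M ^ k * E = z ^ k • E := by
    intro k
    induction k with
    | zero => simp
    | succ k ih => rw [pow_succ, mul_assoc, h, mul_smul_comm, ih, smul_smul, pow_succ, mul_comm]
  have h1 := (NormedSpace.exp_series_hasSum_exp' (𝕂 := ℂ) M).mul_right E
  have h2 := (NormedSpace.exp_series_hasSum_exp' (𝕂 := ℂ) z).smul_const E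
  rw [Complex.exp_eq_exp_ℂ]
  have h3 : ∀ k : ℕ, ((k.factorial : ℂ)⁻¹ • M ^ k) * E = ((k.factorial : ℂ)⁻¹ • z ^ k) • E := by
    intro k
    rw [smul_mul_assoc, hpow, smul_smul, smul_eq_mul]
  simp only [h3] at h1
  exact h1.unique h2

/-- The trace of a projection is its rank. -/
theorem trace_eq_natCast_of_isIdempotentElem {V : Type*} [Fintype V] [DecidableEq V]
    {E : Matrix V V ℂ} (h : E * E = E) : ∃ k : ℕ, E.trace = k := by
  have hid : IsIdempotentElem (Matrix.toLin' E) := by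
    rw [IsIdempotentElem, Module.End.mul_eq_comp, ← Matrix.toLin'_mul, h]
  have htr := (LinearMap.IsIdempotentElem.isProj_range _ hid).trace
  rw [Matrix.trace_toLin'_eq] at htr
  exact ⟨_, htr⟩

/-! ### Matrix identities of the cover -/

/-- The permutation matrix of `σ`. -/
def swapMatrix {V : Type*} [DecidableEq V] (σ : V → V) : Matrix V V ℂ :=
  Matrix.of fun u v => if u = σ v then 1 else 0

/-- The all-ones matrix. -/
def onesMatrix (V : Type*) : Matrix V V ℂ := Matrix.of fun _ _ => 1

namespace IsFibreSwap

variable {V : Type*} [Fintype V] [DecidableEq V] {X : SimpleGraph V}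
  {σ : V → V} {n c : ℕ}

theorem mul_swapMatrix_apply (M : Matrix V V ℂ) (u v : V) :
    (M * swapMatrix σ) u v = M u (σ v) := by
  simp [Matrix.mul_apply, swapMatrix]

theorem swapMatrix_mul_apply (h : IsFibreSwap X σ) (M : Matrix V V ℂ) (u v : V) :
    (swapMatrix σ * M) u v = M (σ u) v := by
  have : ∀ w, u = σ w ↔ w = σ u := fun w =>
    ⟨fun e => by rw [e, h.invol], fun e => by rw [e, h.invol]⟩
  simp [Matrix.mul_apply, swapMatrix, this]

theorem swapMatrix_sq (h : IsFibreSwap X σ) : swapMatrix σ * swapMatrix σ = 1 := by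
  ext u v
  rw [mul_swapMatrix_apply]
  simp [swapMatrix, h.invol, Matrix.one_apply]

theorem swapMatrix_mul_onesMatrix (h : IsFibreSwap X σ) :
    swapMatrix σ * onesMatrix V = onesMatrix V := by
  ext u v
  rw [h.swapMatrix_mul_apply]; rfl

variable [DecidableRel X.Adj]

theorem swapMatrix_mul_adjMatrix (h : IsFibreSwap X σ) :
    swapMatrix σ * X.adjMatrix ℂ = X.adjMatrix ℂ * swapMatrix σ := by
  ext u v
  rw [mul_swapMatrix_apply, h.swapMatrix_mul_apply]
  have : X.Adj (σ u) v ↔ X.Adj u (σ v) := by rw [← h.adj_swap, h.invol]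
  simp [adjMatrix_apply, this]

/-- A vertex has exactly one neighbour in each cell other than its own, and none in its own. -/
theorem adjMatrix_mul_one_add_swapMatrix (h : IsFibreSwap X σ) :
    X.adjMatrix ℂ * (1 + swapMatrix σ) = onesMatrix V - (1 + swapMatrix σ) := by
  ext u v
  rw [mul_add, mul_one, Matrix.add_apply, mul_swapMatrix_apply]
  have key := h.adj_iff u v
  simp only [adjMatrix_apply, onesMatrix, swapMatrix, Matrix.sub_apply, Matrix.add_apply,
    Matrix.of_apply, Matrix.one_apply]
  by_cases h1 : v = u
  · subst h1
    simp [h.not_adj, (h.ne v).symm]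
  by_cases h2 : v = σ u
  · subst h2
    simp [h.invol, h.not_adj, (h.ne u).symm]
  have h3 : u ≠ σ v := fun e => h2 (by rw [e, h.invol])
  by_cases ha : X.Adj u (σ v) <;> simp [key h1 h2, ha, Ne.symm h1, h3]

theorem adjMatrix_mul_onesMatrix (h : IsFibreSwap X σ) (hn : Fintype.card V = 2 * n) :
    X.adjMatrix ℂ * onesMatrix V = ((n : ℂ) - 1) • onesMatrix V := by
  have h1 := congrArg (· * onesMatrix V) h.adjMatrix_mul_one_add_swapMatrix
  simp only [mul_assoc, add_mul, sub_mul, one_mul, h.swapMatrix_mul_onesMatrix] at h1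
  have h2 : onesMatrix V * onesMatrix V = (2 * n : ℂ) • onesMatrix V := by
    ext u v
    simp [Matrix.mul_apply, onesMatrix, hn]
  rw [h2, mul_add, ← two_smul ℂ, ← two_smul ℂ (onesMatrix V)] at h1
  have h3 : (2 : ℂ) • (X.adjMatrix ℂ * onesMatrix V) = (2 : ℂ) • ((n : ℂ) - 1) • onesMatrix V := by
    rw [h1, smul_smul, ← sub_smul]
    congr 1; ring
  exact smul_right_injective _ two_ne_zero h3

theorem adjMatrix_sq_apply_self (h : IsFibreSwap X σ) (hn : Fintype.card V = 2 * n) (u : V) :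
    (X.adjMatrix ℂ * X.adjMatrix ℂ) u u = (n : ℂ) - 1 := by
  have h1 := congrFun (congrFun (h.adjMatrix_mul_onesMatrix hn) u) u
  simp only [Matrix.mul_apply, onesMatrix, Matrix.of_apply, Matrix.smul_apply, smul_eq_mul,
    mul_one] at h1
  rw [← h1, Matrix.mul_apply]
  refine Finset.sum_congr rfl fun w _ => ?_
  by_cases hw : X.Adj u w <;> simp [adjMatrix_apply, hw, X.adj_comm w u]

theorem adjMatrix_sq_apply_swap (h : IsFibreSwap X σ) (u : V) :
    (X.adjMatrix ℂ * X.adjMatrix ℂ) u (σ u) = 0 := by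
  rw [Matrix.mul_apply]
  refine Finset.sum_eq_zero fun w _ => ?_
  by_cases hw : X.Adj u w
  · have h1 : ¬ X.Adj w (σ u) := by
      rw [← h.adj_iff w u hw.ne fun e => h.not_adj w (e ▸ hw.symm)]
      exact hw.symm
    simp [adjMatrix_apply, h1]
  · simp [adjMatrix_apply, hw]

theorem adjMatrix_sq_apply_of_dist_eq_two
    (hc : ∀ u v : V, X.dist u v = 2 → (X.commonNeighbors u v).ncard = c) {u v : V}
    (huv : X.dist u v = 2) : (X.adjMatrix ℂ * X.adjMatrix ℂ) u v = c := by
  rw [← hc u v huv, Set.ncard_eq_toFinset_card', Matrix.mul_apply]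
  have : ∀ w, X.adjMatrix ℂ u w * X.adjMatrix ℂ w v
      = if w ∈ (X.commonNeighbors u v).toFinset then 1 else 0 := by
    intro w
    by_cases h1 : X.Adj u w <;> by_cases h2 : X.Adj v w <;>
      simp [adjMatrix_apply, mem_commonNeighbors, h1, h2, X.adj_comm w v]
  simp only [this, Finset.sum_ite_mem, Finset.univ_inter, Finset.sum_const, nsmul_eq_mul, mul_one]

theorem adjMatrix_sq_add_swap (h : IsFibreSwap X σ) (hn : Fintype.card V = 2 * n) {u v : V}
    (h1 : v ≠ u) (h2 : v ≠ σ u) :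
    (X.adjMatrix ℂ * X.adjMatrix ℂ) u v + (X.adjMatrix ℂ * X.adjMatrix ℂ) u (σ v) = n - 2 := by
  have e : X.adjMatrix ℂ * X.adjMatrix ℂ * (1 + swapMatrix σ)
      = ((n : ℂ) - 2) • onesMatrix V + (1 + swapMatrix σ) := by
    rw [mul_assoc, h.adjMatrix_mul_one_add_swapMatrix, mul_sub, h.adjMatrix_mul_onesMatrix hn,
      h.adjMatrix_mul_one_add_swapMatrix]
    module
  have h3 : u ≠ σ v := fun e => h2 (by rw [e, h.invol])
  have := congrFun (congrFun e u) v
  rw [mul_add, mul_one, Matrix.add_apply, mul_swapMatrix_apply] at this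
  rw [this]
  simp [onesMatrix, swapMatrix, Ne.symm h1, h3]

/-- Outside the cell of u, exactly one of v, σv is nonadjacent to u. Its entry of A² is c and the
other is n - 2 - c, so they differ by ±δ, with the sign of the entry of A(1 - P). -/
theorem adjMatrix_sq_mul_one_sub_swapMatrix (h : IsFibreSwap X σ) (hn : Fintype.card V = 2 * n)
    (hX : IsDistanceRegular X)
    (hc : ∀ u v : V, X.dist u v = 2 → (X.commonNeighbors u v).ncard = c) :
    X.adjMatrix ℂ * (X.adjMatrix ℂ * (1 - swapMatrix σ))
      = ((n : ℂ) - 1) • (1 - swapMatrix σ)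
        + ((n : ℂ) - 2 * c - 2) • (X.adjMatrix ℂ * (1 - swapMatrix σ)) := by
  ext u v
  rw [← mul_assoc]
  simp only [mul_sub, mul_one, Matrix.sub_apply, Matrix.add_apply, Matrix.smul_apply,
    mul_swapMatrix_apply, smul_eq_mul]
  have hu := (h.ne u).symm
  by_cases h1 : v = u
  · subst h1
    rw [h.adjMatrix_sq_apply_self hn, h.adjMatrix_sq_apply_swap]
    simp [adjMatrix_apply, swapMatrix, h.not_adj, hu]
  by_cases h2 : v = σ u
  · subst h2
    rw [h.invol, h.adjMatrix_sq_apply_self hn, h.adjMatrix_sq_apply_swap]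
    simp [adjMatrix_apply, swapMatrix, h.not_adj, hu, h.invol]
  have h3 : u ≠ σ v := fun e => h2 (by rw [e, h.invol])
  have hsum := h.adjMatrix_sq_add_swap hn h1 h2
  have hadj := h.adj_iff u v h1 h2
  by_cases ha : X.Adj u v
  · have hna := hadj.1 ha
    have hd := adjMatrix_sq_apply_of_dist_eq_two hc
      (h.dist_eq_two hX h3.symm (fun e => h1 (by rw [← h.invol v, e, h.invol])) hna)
    simp only [adjMatrix_apply, swapMatrix, Matrix.of_apply, Matrix.one_apply, ha, hna, h3,
      Ne.symm h1, if_true, if_false]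
    linear_combination hsum - 2 * hd
  · have hna : X.Adj u (σ v) := not_not.1 (fun e => ha (hadj.2 e))
    have hd := adjMatrix_sq_apply_of_dist_eq_two hc (h.dist_eq_two hX h1 h2 ha)
    simp only [adjMatrix_apply, swapMatrix, Matrix.of_apply, Matrix.one_apply, ha, hna, h3,
      Ne.symm h1, if_true, if_false]
    linear_combination 2 * hd - hsum

end IsFibreSwap

/-! ### Spectral decomposition -/

variable {V : Type*} [Fintype V] [DecidableEq V] {X : SimpleGraph V} [DecidableRel X.Adj]
  {σ : V → V} {n c : ℕ} {ε s : ℂ}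

/-- The projection onto the eigenspace of `ε + s`, where `s ^ 2 = n`, of a two-fold cover of `K_n`
with `δ = 2 ε`. -/
noncomputable def oddProjection (X : SimpleGraph V) [DecidableRel X.Adj] (σ : V → V) (ε s : ℂ) :
    Matrix V V ℂ :=
  (1 / 4 : ℂ) • ((1 - swapMatrix σ)
    + s⁻¹ • (X.adjMatrix ℂ * (1 - swapMatrix σ) - ε • (1 - swapMatrix σ)))

/-- The projection onto the eigenspace of `-1`. -/
noncomputable def evenProjection (σ : V → V) (n : ℕ) : Matrix V V ℂ :=
  (1 / 2 : ℂ) • (1 + swapMatrix σ) - (1 / (2 * n) : ℂ) • onesMatrix V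

namespace IsFibreSwap

theorem adjMatrix_mul_oddProjection
    (hodd : X.adjMatrix ℂ * (X.adjMatrix ℂ * (1 - swapMatrix σ))
      = ((n : ℂ) - 1) • (1 - swapMatrix σ) + (2 * ε) • (X.adjMatrix ℂ * (1 - swapMatrix σ)))
    (hε : ε * ε = 1) (hs : s * s = n) (hs0 : s ≠ 0) :
    X.adjMatrix ℂ * oddProjection X σ ε s = (ε + s) • oddProjection X σ ε s := by
  unfold oddProjection
  generalize 1 - swapMatrix σ = D at *
  rw [mul_smul_comm, mul_add, mul_smul_comm, mul_sub, mul_smul_comm, hodd, ← hs]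
  generalize X.adjMatrix ℂ * D = B
  match_scalars
  · field_simp
    ring
  · field_simp
    linear_combination hε

theorem adjMatrix_mul_evenProjection (h : IsFibreSwap X σ) (hn : Fintype.card V = 2 * n)
    (hn0 : n ≠ 0) :
    X.adjMatrix ℂ * evenProjection σ n = (-1 : ℂ) • evenProjection σ n := by
  have hn0' : (n : ℂ) ≠ 0 := Nat.cast_ne_zero.2 hn0
  unfold evenProjection
  rw [mul_sub, mul_smul_comm, mul_smul_comm, h.adjMatrix_mul_one_add_swapMatrix,
    h.adjMatrix_mul_onesMatrix hn]
  generalize 1 + swapMatrix σ = D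
  match_scalars
  · field_simp
    ring
  · field_simp

/-- Only the eigenvector equations and the fact that the four matrices sum to 1 are needed, not
their orthogonality. -/
theorem transitionMatrix_eq (h : IsFibreSwap X σ) (hn : Fintype.card V = 2 * n) (hn0 : n ≠ 0)
    (hodd : X.adjMatrix ℂ * (X.adjMatrix ℂ * (1 - swapMatrix σ))
      = ((n : ℂ) - 1) • (1 - swapMatrix σ) + (2 * ε) • (X.adjMatrix ℂ * (1 - swapMatrix σ)))
    (hε : ε * ε = 1) (hs : s * s = n) (hs0 : s ≠ 0) (t : ℝ) :
    transitionMatrix X t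
      = (Complex.exp (Complex.I * t * (n - 1)) * (1 / (2 * n))) • onesMatrix V
        + Complex.exp (Complex.I * t * (-1)) • evenProjection σ n
        + Complex.exp (Complex.I * t * (ε + s)) • oddProjection X σ ε s
        + Complex.exp (Complex.I * t * (ε + -s)) • oddProjection X σ ε (-s) := by
  have key : ∀ {E : Matrix V V ℂ} {z : ℂ}, X.adjMatrix ℂ * E = z • E →
      transitionMatrix X t * E = Complex.exp (Complex.I * t * z) • E := by
    intro E z hE
    refine exp_mul_of_mul_eq_smul ?_
    rw [smul_mul_assoc, hE, smul_smul]
  have hone : (1 : Matrix V V ℂ) = (1 / (2 * n) : ℂ) • onesMatrix V + evenProjection σ n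
      + oddProjection X σ ε s + oddProjection X σ ε (-s) := by
    unfold evenProjection oddProjection
    rw [inv_neg]
    module
  rw [← mul_one (transitionMatrix X t)]
  conv_lhs => rw [hone]
  rw [mul_add, mul_add, mul_add, mul_smul_comm, key (h.adjMatrix_mul_onesMatrix hn),
    key (h.adjMatrix_mul_evenProjection hn hn0), key (adjMatrix_mul_oddProjection hodd hε hs hs0),
    key (adjMatrix_mul_oddProjection hodd hε (by rw [neg_mul_neg, hs]) (neg_ne_zero.2 hs0)),
    smul_smul, mul_comm (1 / (2 * n : ℂ))]

theorem oddProjection_idempotent (h : IsFibreSwap X σ)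
    (hodd : X.adjMatrix ℂ * (X.adjMatrix ℂ * (1 - swapMatrix σ))
      = ((n : ℂ) - 1) • (1 - swapMatrix σ) + (2 * ε) • (X.adjMatrix ℂ * (1 - swapMatrix σ)))
    (hε : ε * ε = 1) (hs : s * s = n) (hs0 : s ≠ 0) :
    oddProjection X σ ε s * oddProjection X σ ε s = oddProjection X σ ε s := by
  have hA := adjMatrix_mul_oddProjection hodd hε hs hs0
  have hDD : (1 - swapMatrix σ) * (1 - swapMatrix σ) = (2 : ℂ) • (1 - swapMatrix σ) := by
    simp only [mul_sub, sub_mul, one_mul, mul_one, h.swapMatrix_sq]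
    module
  have hDA : (1 - swapMatrix σ) * X.adjMatrix ℂ = X.adjMatrix ℂ * (1 - swapMatrix σ) := by
    rw [mul_sub, sub_mul, h.swapMatrix_mul_adjMatrix, one_mul, mul_one]
  have hD : (1 - swapMatrix σ) * oddProjection X σ ε s = (2 : ℂ) • oddProjection X σ ε s := by
    unfold oddProjection
    generalize 1 - swapMatrix σ = D at *
    rw [mul_smul_comm, mul_add, mul_smul_comm, mul_sub, mul_smul_comm, ← mul_assoc, hDA, mul_assoc,
      hDD, mul_smul_comm]
    module
  -- Only the left factor is expanded: on the right one, 1 - P acts as 2 and A as ε + s.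
  conv_lhs => enter [1]; unfold oddProjection
  generalize oddProjection X σ ε s = E at *
  generalize 1 - swapMatrix σ = D at *
  rw [smul_mul_assoc, add_mul, smul_mul_assoc, sub_mul, smul_mul_assoc, mul_assoc, hD,
    mul_smul_comm, hA]
  match_scalars
  field_simp
  ring

theorem trace_oddProjection (h : IsFibreSwap X σ) (hn : Fintype.card V = 2 * n) :
    (oddProjection X σ ε s).trace = (n - s⁻¹ * ε * n) / 2 := by
  have h1 : (1 - swapMatrix σ).trace = (2 * n : ℂ) := by
    have : (swapMatrix σ).trace = 0 := by
      simp [Matrix.trace, swapMatrix, (h.ne _).symm]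
    simp [Matrix.trace_sub, Matrix.trace_one, this, hn]
  have h2 : (X.adjMatrix ℂ * (1 - swapMatrix σ)).trace = 0 := by
    refine Finset.sum_eq_zero fun u _ => ?_
    rw [Matrix.diag_apply, mul_sub, mul_one, Matrix.sub_apply, mul_swapMatrix_apply]
    simp [adjMatrix_apply, h.not_adj]
  simp only [oddProjection, Matrix.trace_smul, Matrix.trace_add, Matrix.trace_sub, h1, h2,
    smul_eq_mul]
  ring

/-- The square root of `n` is an even integer. -/
theorem exists_sqrt_eq_two_mul (h : IsFibreSwap X σ) (hn : Fintype.card V = 2 * n) (hn0 : n ≠ 0)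
    (heven : Even n)
    (hodd : X.adjMatrix ℂ * (X.adjMatrix ℂ * (1 - swapMatrix σ))
      = ((n : ℂ) - 1) • (1 - swapMatrix σ) + (2 * ε) • (X.adjMatrix ℂ * (1 - swapMatrix σ)))
    (hε : ε = 1 ∨ ε = -1) : ∃ r : ℕ, n = (2 * r) ^ 2 := by
  have hsR : Real.sqrt n * Real.sqrt n = n := Real.mul_self_sqrt (Nat.cast_nonneg n)
  obtain ⟨s, hs⟩ : ∃ s : ℂ, s * s = n := ⟨(Real.sqrt n : ℝ), by exact_mod_cast hsR⟩
  have hs0 : s ≠ 0 := by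
    rintro rfl
    rw [mul_zero] at hs
    exact hn0 (by exact_mod_cast hs.symm)
  obtain ⟨k, hk⟩ := trace_eq_natCast_of_isIdempotentElem
    (h.oddProjection_idempotent hodd (by rcases hε with rfl | rfl <;> norm_num) hs hs0)
  rw [h.trace_oddProjection hn, ← hs] at hk
  have hk' : s * s - ε * s = 2 * k := by
    rw [← hk]
    field_simp
  -- Here n - 2k = εs, so εs is an integer.
  have hint : ((n : ℤ) - 2 * k) ^ 2 = n := by
    have : ((n : ℂ) - 2 * k) ^ 2 = n := by
      rw [← hk', ← hs]
      rcases hε with rfl | rfl <;> ring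
    exact_mod_cast this
  obtain ⟨m, hm⟩ := heven
  refine ⟨((m : ℤ) - k).natAbs, ?_⟩
  zify
  rw [mul_pow, sq_abs, ← hint]
  rw [hm]
  push_cast
  ring

/-! ### State transfer in terms of phases -/

theorem admitsPSTAt_of_exp_eq (h : IsFibreSwap X σ) [Nonempty V] (hn : Fintype.card V = 2 * n)
    (hn0 : n ≠ 0)
    (hodd : X.adjMatrix ℂ * (X.adjMatrix ℂ * (1 - swapMatrix σ))
      = ((n : ℂ) - 1) • (1 - swapMatrix σ) + (2 * ε) • (X.adjMatrix ℂ * (1 - swapMatrix σ)))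
    (hε : ε * ε = 1) (hs : s * s = n) (hs0 : s ≠ 0) (t : ℝ)
    (h1 : Complex.exp (Complex.I * t * (n - 1)) = Complex.exp (Complex.I * t * (-1)))
    (h2 : Complex.exp (Complex.I * t * (ε + s)) = -Complex.exp (Complex.I * t * (-1)))
    (h3 : Complex.exp (Complex.I * t * (ε + -s)) = -Complex.exp (Complex.I * t * (-1))) :
    AdmitsPSTAt X t := by
  obtain ⟨u⟩ := ‹Nonempty V›
  have hU : transitionMatrix X t = Complex.exp (Complex.I * t * (-1)) • swapMatrix σ := by
    rw [h.transitionMatrix_eq hn hn0 hodd hε hs hs0, h1, h2, h3]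
    unfold evenProjection oddProjection
    rw [inv_neg]
    module
  refine ⟨u, σ u, (h.ne u).symm, Complex.exp (Complex.I * t * (-1)), ?_⟩
  rw [hU, Matrix.mulVec_single_one]
  ext x
  simp [swapMatrix, Pi.single_apply]

theorem exp_eq_of_admitsPSTAt (h : IsFibreSwap X σ) (hn : Fintype.card V = 2 * n)
    (hn0 : 2 < n)
    (hodd : X.adjMatrix ℂ * (X.adjMatrix ℂ * (1 - swapMatrix σ))
      = ((n : ℂ) - 1) • (1 - swapMatrix σ) + (2 * ε) • (X.adjMatrix ℂ * (1 - swapMatrix σ)))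
    (hε : ε * ε = 1) (hs : s * s = n) (hs0 : s ≠ 0) {t : ℝ} (ht : AdmitsPSTAt X t) :
    Complex.exp (Complex.I * t * (ε + s)) = -Complex.exp (Complex.I * t * (-1)) ∧
    Complex.exp (Complex.I * t * (ε + -s)) = -Complex.exp (Complex.I * t * (-1)) := by
  obtain ⟨u, v, huv, γ, hγ⟩ := ht
  have hU : ∀ x, x ≠ v → transitionMatrix X t x u = 0 := by
    intro x hx
    rw [Matrix.mulVec_single_one] at hγ
    simpa [hx] using congrFun hγ x
  rw [h.transitionMatrix_eq hn (by omega) hodd hε hs hs0] at hU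
  have ha : ‖Complex.exp (Complex.I * t * (n - 1))‖ = 1 := by
    rw [show Complex.I * t * ((n : ℂ) - 1) = ((t * (n - 1) : ℝ) : ℂ) * Complex.I by push_cast; ring]
    exact Complex.norm_exp_ofReal_mul_I _
  have hb : ‖Complex.exp (Complex.I * t * (-1))‖ = 1 := by
    rw [show Complex.I * t * (-1) = ((-t : ℝ) : ℂ) * Complex.I by push_cast; ring]
    exact Complex.norm_exp_ofReal_mul_I _
  generalize Complex.exp (Complex.I * t * (n - 1)) = a at *
  generalize Complex.exp (Complex.I * t * (-1)) = b at *
  generalize Complex.exp (Complex.I * t * (ε + s)) = p at *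
  generalize Complex.exp (Complex.I * t * (ε + -s)) = q at *
  have hn0' : (n : ℂ) ≠ 0 := Nat.cast_ne_zero.2 (by omega)
  have hu := (h.ne u).symm
  have hentry : ∀ x, x ≠ v → a * (1 / (2 * n))
      + b * (1 / 2 * ((if x = u then 1 else 0) + if x = σ u then 1 else 0) - 1 / (2 * n))
      + p * (1 / 4 * (((if x = u then 1 else 0) - if x = σ u then 1 else 0)
        + s⁻¹ * ((if X.Adj x u then 1 else 0) - (if X.Adj x (σ u) then 1 else 0)
          - ε * ((if x = u then 1 else 0) - if x = σ u then 1 else 0))))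
      + q * (1 / 4 * (((if x = u then 1 else 0) - if x = σ u then 1 else 0)
        - s⁻¹ * ((if X.Adj x u then 1 else 0) - (if X.Adj x (σ u) then 1 else 0)
          - ε * ((if x = u then 1 else 0) - if x = σ u then 1 else 0)))) = 0 := by
    intro x hx
    refine Eq.trans ?_ (hU x hx)
    simp only [oddProjection, evenProjection, mul_sub, mul_one, Matrix.add_apply, Matrix.sub_apply,
      Matrix.smul_apply, mul_swapMatrix_apply, adjMatrix_apply, smul_eq_mul, inv_neg]
    simp only [onesMatrix, swapMatrix, Matrix.of_apply, Matrix.one_apply]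
    ring
  -- Otherwise the entries at u and σu both vanish. In their sum the odd part cancels, leaving a =
  -- -(n - 1)b, impossible for unit a, b when n > 2.
  have hvu : v = σ u := by
    by_contra hv
    have e1 := hentry u huv
    have e2 := hentry (σ u) (Ne.symm hv)
    have hadj : ¬ X.Adj (σ u) u := fun e => h.not_adj u e.symm
    simp only [if_true, if_false, hu, hu.symm, X.irrefl, hadj, h.not_adj] at e1 e2
    have e3 : a = -((n - 1 : ℝ) : ℂ) * b := by
      have : a * (1 / n) + b * (1 - 1 / n) = 0 := by linear_combination e1 + e2
      field_simp at this
      push_cast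
      linear_combination this
    rw [e3, norm_mul, hb, norm_neg, Complex.norm_real, mul_one] at ha
    have h2n : (2 : ℝ) < n := by exact_mod_cast hn0
    rw [Real.norm_of_nonneg (by linarith)] at ha
    linarith
  subst hvu
  -- In another cell both entries vanish: their sum gives a = b, their difference p = q. The entry
  -- at u then gives p = -a.
  obtain ⟨w, hwu, hwσ⟩ : ∃ w, w ≠ u ∧ w ≠ σ u := by
    by_contra! hno
    have : (Finset.univ : Finset V) ⊆ {u, σ u} := fun w _ => by
      by_cases hw : w = u
      · simp [hw]
      · simp [hno w hw]
    have := (Finset.card_le_card this).trans Finset.card_le_two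
    rw [Finset.card_univ, hn] at this
    omega
  have hwu' : σ w ≠ u := fun e => hwσ (by rw [← e, h.invol])
  have hwσ' : σ w ≠ σ u := fun e => hwu (by rw [← h.invol w, e, h.invol])
  have e0 := hentry u hu
  have e1 := hentry w hwσ
  have e2 := hentry (σ w) hwσ'
  have hadj := h.adj_iff w u hwu.symm (Ne.symm hwu')
  have hadj1 : X.Adj (σ w) u ↔ X.Adj w (σ u) := by rw [← h.adj_swap, h.invol]
  simp only [if_true, if_false, hu, X.irrefl, h.not_adj, hwu, hwσ, hwu', hwσ', h.adj_swap, hadj1]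
    at e0 e1 e2
  have hab : a = b := by
    have : (a - b) * (1 / n) = 0 := by linear_combination e1 + e2
    have h1n : (1 / n : ℂ) ≠ 0 := one_div_ne_zero hn0'
    exact sub_eq_zero.1 ((mul_eq_zero.1 this).resolve_right h1n)
  have hpq : p = q := by
    refine sub_eq_zero.1 ((mul_eq_zero.1 (?_ : (p - q) * s⁻¹ = 0)).resolve_right (inv_ne_zero hs0))
    by_cases hw : X.Adj w (σ u)
    · have hw' : ¬ X.Adj w u := fun e => hadj.1 e hw
      simp only [hw, hw', if_true, if_false] at e1 e2
      linear_combination 2 * e2 - 2 * e1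
    · have hw' : X.Adj w u := hadj.2 hw
      simp only [hw, hw', if_true, if_false] at e1 e2
      linear_combination 2 * e1 - 2 * e2
  subst hab hpq
  have hp : p = -a := by linear_combination 2 * e0
  exact ⟨hp, hp⟩

end IsFibreSwap
end QuantumWalk

/-! ### Arithmetic of the phases -/

theorem mainTheorem5 {V : Type*} [Fintype V] [DecidableEq V]
    (X : SimpleGraph V) [DecidableRel X.Adj] (n c : ℕ)
    (hreg : QuantumWalk.IsDistanceRegular X)
    (hcov : QuantumWalk.IsFoldCovering 2 X (⊤ : SimpleGraph (Fin n)))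
    (hc : ∀ u v : V, X.dist u v = 2 → (X.commonNeighbors u v).ncard = c) :
    (QuantumWalk.coverDelta n 2 c = -2 →
      QuantumWalk.AdmitsPSTAt X (Real.pi / Real.sqrt (n : ℝ))) ∧
    (QuantumWalk.coverDelta n 2 c = 2 →
      (QuantumWalk.AdmitsPST X ↔ 8 ∣ n) ∧
      (8 ∣ n → QuantumWalk.AdmitsPSTAt X (Real.pi / 2))) := by
  obtain ⟨⟨σ, h⟩, hn⟩ := hcov.exists_isFibreSwap
  have : Nonempty V := hreg.1.nonempty
  have hn0 : n ≠ 0 := by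
    rintro rfl
    exact Fintype.card_ne_zero hn
  have hodd := h.adjMatrix_sq_mul_one_sub_swapMatrix hn hreg hc
  have hneg : ∀ z : ℂ, -Complex.exp z = Complex.exp (z + Real.pi * Complex.I) := fun z => by
    rw [Complex.exp_add, Complex.exp_pi_mul_I, mul_neg_one]
  constructor
  · intro hδ
    unfold QuantumWalk.coverDelta at hδ
    have hδ' : (n : ℂ) - 2 * c - 2 = 2 * (-1) := by
      have : (((n : ℤ) - (2 : ℕ) * c - 2 : ℤ) : ℂ) = ((-2 : ℤ) : ℂ) := by rw [hδ]
      push_cast at this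
      rw [this]; norm_num
    rw [hδ'] at hodd
    obtain ⟨r, hr⟩ := h.exists_sqrt_eq_two_mul hn hn0 ⟨c, by omega⟩ hodd (Or.inr rfl)
    have hr0 : (r : ℂ) ≠ 0 := Nat.cast_ne_zero.2 (by rintro rfl; simp at hr; exact hn0 hr)
    have hsqrt : Real.sqrt n = 2 * r := by
      rw [hr]; push_cast
      exact Real.sqrt_sq (by positivity)
    have hnC : (n : ℂ) = (2 * r) ^ 2 := by rw [hr]; push_cast; ring
    refine h.admitsPSTAt_of_exp_eq (s := 2 * r) hn hn0 hodd (by norm_num) (by rw [hnC]; ring)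
      (mul_ne_zero two_ne_zero hr0) _ ?_ ?_ ?_
    · rw [Complex.exp_eq_exp_iff_exists_int]
      -- With t = π/(2r) and n = 4r², tn = 2πr.
      refine ⟨r, ?_⟩
      rw [hsqrt, hnC]; push_cast; field_simp; ring
    · rw [hneg]
      congr 1
      rw [hsqrt]; push_cast; field_simp
    · rw [hneg,
        Complex.exp_eq_exp_iff_exists_int]
      refine ⟨-1, ?_⟩
      rw [hsqrt]; push_cast; field_simp; ring
  · intro hδ
    unfold QuantumWalk.coverDelta at hδ
    have hδ' : (n : ℂ) - 2 * c - 2 = 2 * 1 := by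
      have : (((n : ℤ) - (2 : ℕ) * c - 2 : ℤ) : ℂ) = ((2 : ℤ) : ℂ) := by rw [hδ]
      push_cast at this
      rw [this]; norm_num
    rw [hδ'] at hodd
    obtain ⟨r, hr⟩ := h.exists_sqrt_eq_two_mul hn hn0 ⟨c + 2, by omega⟩ hodd (Or.inl rfl)
    have hr0 : (r : ℂ) ≠ 0 := Nat.cast_ne_zero.2 (by rintro rfl; simp at hr; exact hn0 hr)
    have hnC : (n : ℂ) = (2 * r) ^ 2 := by rw [hr]; push_cast; ring
    have hs : (2 * r : ℂ) * (2 * r) = n := by rw [hnC]; ring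
    have hs0 : (2 * r : ℂ) ≠ 0 := mul_ne_zero two_ne_zero hr0
    have hpst : 8 ∣ n → QuantumWalk.AdmitsPSTAt X (Real.pi / 2) := by
      intro h8
      -- An odd r would give n ≡ 4 mod 8.
      obtain ⟨q, hq⟩ : Even r := by
        by_contra hne
        obtain ⟨k, rfl⟩ := Nat.not_even_iff_odd.1 hne
        have : n = 8 * (2 * k ^ 2 + 2 * k) + 4 := by rw [hr]; ring
        omega
      have hq' : (r : ℂ) = q + q := by rw [hq]; push_cast; ring
      refine h.admitsPSTAt_of_exp_eq (s := 2 * r) hn hn0 hodd (by norm_num) hs hs0 _ ?_ ?_ ?_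
      · rw [Complex.exp_eq_exp_iff_exists_int]
        refine ⟨4 * q ^ 2, ?_⟩
        rw [hnC, hq']; push_cast; ring
      · rw [hneg,
          Complex.exp_eq_exp_iff_exists_int]
        refine ⟨q, ?_⟩
        rw [hq']; push_cast; ring
      · rw [hneg,
          Complex.exp_eq_exp_iff_exists_int]
        refine ⟨-q, ?_⟩
        rw [hq']; push_cast; ring
    refine ⟨⟨?_, fun h8 => ⟨_, by positivity, hpst h8⟩⟩, hpst⟩
    rintro ⟨t, -, ht⟩
    obtain ⟨h1, h2⟩ := h.exp_eq_of_admitsPSTAt hn (by omega) hodd (by norm_num) hs hs0 ht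
    set y := Complex.exp (Complex.I * t) with hy
    have hb : Complex.exp (Complex.I * t * (-1)) * y = 1 := by
      rw [hy, ← Complex.exp_add, mul_neg_one, neg_add_cancel, Complex.exp_zero]
    have hp : Complex.exp (Complex.I * t * (1 + 2 * r)) = y * (y ^ 2) ^ r := by
      rw [hy, ← pow_mul, ← Complex.exp_nat_mul, ← Complex.exp_add]
      congr 1; push_cast; ring
    have hq : Complex.exp (Complex.I * t * (1 + -(2 * r))) * (y ^ 2) ^ r = y := by
      rw [hy, ← pow_mul, ← Complex.exp_nat_mul, ← Complex.exp_add]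
      congr 1; push_cast; ring
    have hz1 : y ^ 2 * (y ^ 2) ^ r = -1 := by
      rw [hp] at h1
      linear_combination y * h1 - hb
    have hz2 : (y ^ 2) ^ r = -y ^ 2 := by
      rw [h2] at hq
      linear_combination (-y) * hq - (y ^ 2) ^ r * hb
    have hz : (y ^ 2) ^ 2 = 1 := by
      rw [hz2] at hz1
      linear_combination -hz1
    -- Since y⁴ = 1, an odd r turns y²·(y²)^r = -1 into 1 = -1.
    rcases Nat.even_or_odd r with ⟨k, rfl⟩ | ⟨k, rfl⟩
    · exact ⟨2 * k ^ 2, by rw [hr]; ring⟩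
    · exfalso
      rw [pow_succ (y ^ 2) (2 * k), pow_mul (y ^ 2), hz, one_pow, one_mul, ← pow_two, hz] at hz1
      norm_num at hz1
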